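/- Let $(X,\mathsf d)$ be a complete separable metric space, let $\mathcal M(\cdot)$ denote finite nonnegative Radon (equivalently, finite Borel) measures, and let $\mu_0,\mu_1\in\mathcal M(X)$, $\nu_X\in\mathcal M(X\times X)$ and $\varepsilon>0$. Let $c:X\times X\to(-\infty,+\infty]$ be lower semicontinuous and bounded from below. Let $F(s)=s\log s-s+1$ for $s\ge 0$ (with $F(0)=1$), so that $F'_\infty:=\lim_{s\to\infty}F(s)/s=+\infty$, and let $R(s)=sF(1/s)$ for $s>0$ and $R(0)=F'_\infty=+\infty$. For finite measures $\gamma,\mu$ on the same space put $$\mathcal F(\gamma\mid\mu)=\int F(\sigma)\,d\mu+F'_\infty\,\gamma^\perp(\text{whole space}),\qquad \gamma=\sigma\mu+\gamma^\perp\ \text{(Lebesgue decomposition)},\quad \infty\cdot0=0 .$$ For $\gamma\in\mathcal M(X\times X)$ let $\gamma_0,\gamma_1$ be its marginals, and define $$\mathrm{UOT}_{X,\varepsilon}(\mu_0,\mu_1)=\inf_{\gamma\in\mathcal M(X\times X)}\Big\{\mathcal F(\gamma_0\mid\mu_0)+\mathcal F(\gamma_1\mid\mu_1)+\int_{X\times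 X} c\,d\gamma+\varepsilon\,\mathcal F(\gamma\mid\nu_X)\Big\}.$$ For $x_0,x_1\in X$ and $s_0,s_1,S\ge0$ define $$H_\varepsilon(x_0,s_0,x_1,s_1,S)=\inf_{t>0}\; t\Big(R\big(\tfrac{s_0}{t}\big)+R\big(\tfrac{s_1}{t}\big)+\varepsilon R\big(\tfrac{S}{t}\big)+c(x_0,x_1)\Big),$$ and, with the Lebesgue decompositions $\mu_i=\rho_i\gamma_i+\mu_i^\perp$ and $\nu_X=\varrho\gamma+\nu_X^\perp$, $$\mathcal H_\varepsilon(\mu_0,\mu_1,\nu_X\mid\gamma)=\int_{X\times X}H_\varepsilon\big(x_0,\rho_0(x_0),x_1,\rho_1(x_1),\varrho(x_0,x_1)\big)\,d\gamma(x_0,x_1)+F(0)\Big(\sum_{i=0,1}\mu_i^\perp(X)+\varepsilon\,\nu_X^\perp(X\times X)\Big).$$ Then $$\mathrm{UOT}_{X,\varepsilon}(\mu_0,\mu_1)=\inf_{\gamma\in\mathcal M(X\times X)}\mathcal H_\varepsilon(\mu_0,\mu_1,\nu_X\mid\gamma).$$ -/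

import Mathlib

open MeasureTheory Filter
open scoped ENNReal NNReal Topology

namespace EUOT

noncomputable section

/-- Integral of an extended-real-valued function: integral of the positive part minus integral of
the negative part. It is only used where the integral of the negative part is finite. -/
def erealIntegral {α : Type*} [MeasurableSpace α] (f : α → EReal) (γ : Measure α) : EReal :=
  ((∫⁻ a, (f a).toENNReal ∂γ : ℝ≥0∞) : EReal) - ((∫⁻ a, (-f a).toENNReal ∂γ : ℝ≥0∞) : EReal)

/-- Recession constant `F'_∞ = lim_{s → ∞} F(s) / s` (the limit exists for convex `F`). -/
def recession (F : ℝ≥0 → ℝ≥0∞) : ℝ≥0∞ :=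
  limsup (fun s : ℝ≥0 => F s / (s : ℝ≥0∞)) atTop

/-- Relative entropy functional `∫ F(σ) dμ + F'_∞ γ^⊥(X)`, where `γ = σ μ + γ^⊥` is the
Lebesgue decomposition of `γ` with respect to `μ` (convention `∞ * 0 = 0`). -/
def relEntropy {α : Type*} [MeasurableSpace α] (F : ℝ≥0 → ℝ≥0∞) (γ μ : Measure α) : ℝ≥0∞ :=
  (∫⁻ a, F ((γ.rnDeriv μ a).toNNReal) ∂μ) + recession F * γ.singularPart μ Set.univ

/-- Reverse entropy function: `R(s) = s F(1/s)` for `s > 0` and `R(0) = F'_∞`. -/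
def reverseEntropy (F : ℝ≥0 → ℝ≥0∞) (s : ℝ≥0) : ℝ≥0∞ :=
  if s = 0 then recession F else (s : ℝ≥0∞) * F s⁻¹

/-- The Kullback-Leibler entropy function `F(s) = s log s - s + 1`, with `F(0) = 1`. -/
def klF (s : ℝ≥0) : ℝ≥0∞ :=
  ENNReal.ofReal ((s : ℝ) * Real.log s - s + 1)

variable {X : Type*} [MeasurableSpace X]

/-- Primal functional `∑ᵢ F(γᵢ | μᵢ) + (c, γ)`, with `γᵢ` the marginals of `γ`. -/
def primal (F : ℝ≥0 → ℝ≥0∞) (c : X × X → EReal) (μ₀ μ₁ : Measure X) (γ : Measure (X × X)) :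
    EReal :=
  ((relEntropy F (γ.map Prod.fst) μ₀ + relEntropy F (γ.map Prod.snd) μ₁ : ℝ≥0∞) : EReal)
    + erealIntegral c γ

/-- Regularised primal functional: the primal functional plus `ε F(γ | ν)`. -/
def primalReg (F : ℝ≥0 → ℝ≥0∞) (ε : ℝ) (c : X × X → EReal) (μ₀ μ₁ : Measure X)
    (ν γ : Measure (X × X)) : EReal :=
  primal F c μ₀ μ₁ γ + (ε : EReal) * (relEntropy F γ ν : EReal)

/-- The original-space regularised problem: infimum over finite measures on `X × X`. -/
def UOTReg (F : ℝ≥0 → ℝ≥0∞) (ε : ℝ) (c : X × X → EReal) (μ₀ μ₁ : FiniteMeasure X)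
    (ν : FiniteMeasure (X × X)) : EReal :=
  ⨅ γ : FiniteMeasure (X × X), primalReg F ε c μ₀ μ₁ ν γ

/-- Regularised induced marginal perspective cost
`inf_{t > 0} t (R(s₀/t) + R(s₁/t) + ε R(S/t) + c(x₀, x₁))`. -/
def perspCostReg (F : ℝ≥0 → ℝ≥0∞) (ε : ℝ) (c : X × X → EReal)
    (x₀ : X) (s₀ : ℝ≥0) (x₁ : X) (s₁ : ℝ≥0) (S : ℝ≥0) : EReal :=
  ⨅ (t : ℝ≥0) (_ : 0 < t),
    ((t : ℝ) : EReal) *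
      ((reverseEntropy F (s₀ / t) : EReal) + (reverseEntropy F (s₁ / t) : EReal)
        + (ε : EReal) * (reverseEntropy F (S / t) : EReal) + c (x₀, x₁))

/-- Regularised homogeneous functional. The densities `ρᵢ = dμᵢ/dγᵢ`, `ϱ = dν/dγ` and the missing
masses `μᵢ^⊥(X)`, `ν^⊥(X × X)` come from the Lebesgue decompositions `μᵢ = ρᵢ γᵢ + μᵢ^⊥`,
`ν = ϱ γ + ν^⊥`. -/
def homogReg (F : ℝ≥0 → ℝ≥0∞) (ε : ℝ) (c : X × X → EReal) (μ₀ μ₁ : Measure X)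
    (ν γ : Measure (X × X)) : EReal :=
  erealIntegral (fun p : X × X =>
      perspCostReg F ε c p.1 (μ₀.rnDeriv (γ.map Prod.fst) p.1).toNNReal
        p.2 (μ₁.rnDeriv (γ.map Prod.snd) p.2).toNNReal (ν.rnDeriv γ p).toNNReal) γ
    + (F 0 : EReal) *
      ((μ₀.singularPart (γ.map Prod.fst) Set.univ : EReal)
        + (μ₁.singularPart (γ.map Prod.snd) Set.univ : EReal)
        + (ε : EReal) * (ν.singularPart γ Set.univ : EReal))

end

end EUOT

/-!
For the entropy `F(s) = s log s - s + 1` the relative entropy is Mathlib's Kullback-Leibler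
divergence `klDiv` (`relEntropy_klF`), and `t R(s / t) = s F(t / s)` is the pointwise divergence of
the mass `t` from the mass `s`. The integral of the perspective function at a measurable scale
`t > 0` against `γ` therefore compares the plan `t γ` with the densities of `μ₀, μ₁, ν` relative to `γ`.

* Taking `t = 1` in the perspective cost, the functional `homogReg` at `γ` is at most `primalReg` at
  the same `γ` (`homogReg_klF_le_primalReg`); this is the reverse form of the entropy,
  `lintegral_reverseEntropy_add_singularPart_le`.
* Conversely, the infimum over `t` in the perspective cost is attained at an explicit scale
  `t = exp ((log s₀ + log s₁ + ε log S - c) / (2 + ε))` (`optimalScale`, `perspCostReg_klF_eq`),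
  which is measurable, and integrable because `c` is bounded below. The plan `t γ` satisfies
  `primalReg (t γ) ≤ homogReg γ` (`exists_primalReg_le_homogReg_klF`). The scale `t` depends on
  both coordinates, so the marginals of `t γ` are averages; the data processing inequality
  `klDiv_map_le` shows that averaging only lowers the entropy (`klDiv_map_withDensity_le`).

The costs are extended-real valued. Their integrals split off the nonnegative entropy terms because
the negative part of `t c` is integrable (`erealIntegral_coe_ennreal_add`).
-/

namespace EUOT

open InformationTheory

/-! ### The Kullback-Leibler entropy, its reverse entropy and data processing -/

lemma klF_eq_ofReal_klFun (s : ℝ≥0) : klF s = ENNReal.ofReal (klFun s) := by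
  rw [klF, klFun_apply]; congr 1; ring

lemma klF_zero : klF 0 = 1 := by simp [klF]

lemma measurable_klF : Measurable klF := by
  unfold klF; fun_prop

lemma recession_klF : recession klF = ⊤ := by
  have h : Tendsto (fun s : ℝ≥0 => klF s / (s : ℝ≥0∞)) atTop (𝓝 ⊤) := by
    have h1 : Tendsto (fun s : ℝ≥0 => ENNReal.ofReal (Real.log s - 1)) atTop (𝓝 ⊤) :=
      ENNReal.tendsto_ofReal_nhds_top.2 <| tendsto_atTop_add_const_right _ (-1)
        (Real.tendsto_log_atTop.comp (NNReal.tendsto_coe_atTop.2 tendsto_id))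
    refine tendsto_nhds_top_mono h1 ?_
    filter_upwards [eventually_gt_atTop 0] with s hs
    have hs' : (0 : ℝ) < s := hs
    rw [ENNReal.le_div_iff_mul_le (by simp [hs.ne']) (by simp), klF,
      ← ENNReal.ofReal_coe_nnreal, ← ENNReal.ofReal_mul' hs'.le]
    exact ENNReal.ofReal_le_ofReal (by nlinarith)
  exact h.limsup_eq

lemma relEntropy_klF {α : Type*} [MeasurableSpace α] (γ μ : Measure α)
    [IsFiniteMeasure γ] [IsFiniteMeasure μ] : relEntropy klF γ μ = klDiv γ μ := by
  rw [relEntropy, recession_klF, klDiv_eq_lintegral_klFun]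
  split_ifs with h
  · rw [Measure.singularPart_eq_zero_of_ac h]
    simp [klF_eq_ofReal_klFun, ENNReal.coe_toNNReal_eq_toReal]
  · have : γ.singularPart μ Set.univ ≠ 0 := by
      rwa [Ne, Measure.measure_univ_eq_zero, Measure.singularPart_eq_zero]
    rw [ENNReal.top_mul this, add_top]

lemma reverseEntropy_klF_zero : reverseEntropy klF 0 = ⊤ := by
  simp [reverseEntropy, recession_klF]

lemma measurable_reverseEntropy_klF : Measurable (reverseEntropy klF) := by
  unfold reverseEntropy
  exact Measurable.ite (measurableSet_singleton 0) measurable_const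
    (measurable_coe_nnreal_ennreal.mul (measurable_klF.comp measurable_inv))

lemma mul_reverseEntropy_klF {s t : ℝ≥0} (hs : s ≠ 0) (ht : t ≠ 0) :
    (t : ℝ≥0∞) * reverseEntropy klF (s / t) = s * klF (t / s) := by
  rw [reverseEntropy, if_neg (div_ne_zero hs ht), inv_div, ← mul_assoc, ← ENNReal.coe_mul,
    mul_div_cancel₀ _ ht]

/-- If `μ = r m + μs` with `r > 0` and `μs ⟂ m`, then `t m` has density `t / r` with respect to
`r m`, while `μs` is not charged and contributes its mass times `F(0) = 1`. -/
lemma klDiv_withDensity {α : Type*} [MeasurableSpace α] {m μ μs : Measure α}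
    [IsFiniteMeasure m] [IsFiniteMeasure μ] {t r : α → ℝ≥0∞}
    (ht : Measurable t) (hr : Measurable r) [IsFiniteMeasure (m.withDensity t)]
    (hr0 : ∀ᵐ x ∂m, r x ≠ 0) (hrt : ∀ᵐ x ∂m, r x ≠ ⊤)
    (hs : μs ⟂ₘ m) (hμ : μ = m.withDensity r + μs) :
    klDiv (m.withDensity t) μ
      = ∫⁻ x, r x * ENNReal.ofReal (klFun (t x / r x).toReal) ∂m + μs Set.univ := by
  obtain ⟨E, hE, hsE, hmE⟩ := hs
  have hsE' : ∀ᵐ x ∂μs, x ∉ E := by simpa [ae_iff] using hsE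
  have hmE' : ∀ᵐ x ∂m, x ∈ E := by simpa [ae_iff, Set.compl_def] using hmE
  -- the density of `m.withDensity t` with respect to `μ` vanishes on the carrier `Eᶜ` of `μs`
  set f : α → ℝ≥0∞ := E.indicator (fun x => t x / r x) with hf
  have hfm : Measurable f := (ht.div hr).indicator hE
  have hγ : m.withDensity t = μ.withDensity f := by
    have h0 : μs.withDensity f = 0 := by
      rw [withDensity_eq_zero_iff hfm.aemeasurable]
      filter_upwards [hsE'] with x hx
      simp [hf, hx]
    rw [hμ, withDensity_add_measure, h0, add_zero, ← withDensity_mul _ hr hfm]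
    refine withDensity_congr_ae ?_
    filter_upwards [hmE', hr0, hrt] with x hx h1 h2
    simp [hf, hx, ENNReal.mul_div_cancel h1 h2]
  have hac : m.withDensity t ≪ μ := hγ ▸ withDensity_absolutelyContinuous _ _
  have hd : (m.withDensity t).rnDeriv μ =ᵐ[μ] f := hγ ▸ Measure.rnDeriv_withDensity μ hfm
  rw [klDiv_eq_lintegral_klFun_of_ac hac,
    lintegral_congr_ae (g := fun x => ENNReal.ofReal (klFun (f x).toReal))
      (by filter_upwards [hd] with x hx; rw [hx]),
    hμ, lintegral_add_measure, lintegral_withDensity_eq_lintegral_mul _ hr (by fun_prop)]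
  congr 1
  · refine lintegral_congr_ae ?_
    filter_upwards [hmE'] with x hx
    simp [hf, hx]
  · rw [lintegral_congr_ae (g := fun _ => 1)]
    · simp
    · filter_upwards [hsE'] with x hx
      simp [hf, hx, klFun_zero]

/-- Let `ρ` be the density of `μ` with respect to `γ.map g`. The right-hand side is the divergence
of `t γ` from `(ρ ∘ g) γ`, plus the missing mass of `μ`. Pushing both measures forward by `g` does not
increase the divergence, and the pushforward of `(ρ ∘ g) γ` is the absolutely continuous part of
`μ`. -/
lemma klDiv_map_withDensity_le {α β : Type*} [MeasurableSpace α] [MeasurableSpace β]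
    (γ : Measure α) (μ : Measure β) [IsFiniteMeasure γ] [IsFiniteMeasure μ]
    {g : α → β} (hg : Measurable g) {t : α → ℝ≥0} (ht : Measurable t) (ht0 : ∀ x, t x ≠ 0)
    [IsFiniteMeasure (γ.withDensity fun x => t x)] :
    klDiv ((γ.withDensity fun x => (t x : ℝ≥0∞)).map g) μ
      ≤ ∫⁻ x, t x * reverseEntropy klF ((μ.rnDeriv (γ.map g) (g x)).toNNReal / t x) ∂γ
        + μ.singularPart (γ.map g) Set.univ := by
  set m := γ.map g with hm
  set ρ := μ.rnDeriv m
  have hρm : Measurable ρ := Measure.measurable_rnDeriv _ _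
  set I := ∫⁻ x, t x * reverseEntropy klF ((ρ (g x)).toNNReal / t x) ∂γ
  by_cases hfin : I = ⊤
  · simp [hfin]
  have hRm : Measurable fun x => (t x : ℝ≥0∞) * reverseEntropy klF ((ρ (g x)).toNNReal / t x) :=
    ht.coe_nnreal_ennreal.mul
      (measurable_reverseEntropy_klF.comp ((hρm.comp hg).ennreal_toNNReal.div ht))
  have hρtop : ∀ᵐ y ∂m, ρ y ≠ ⊤ := Measure.rnDeriv_ne_top _ _
  have hρtop' : ∀ᵐ x ∂γ, ρ (g x) ≠ ⊤ := ae_of_ae_map hg.aemeasurable hρtop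
  -- since `R(0) = ∞`, finiteness of the integral forces `ρ ∘ g` to be positive
  have hρ0' : ∀ᵐ x ∂γ, ρ (g x) ≠ 0 := by
    filter_upwards [ae_lt_top hRm hfin] with x hx h0
    simp [h0, reverseEntropy_klF_zero, ht0 x] at hx
  have hρ0 : ∀ᵐ y ∂m, ρ y ≠ 0 :=
    (ae_map_iff hg.aemeasurable (hρm (measurableSet_singleton 0).compl)).2 hρ0'
  have hmap : m.withDensity ρ = (γ.withDensity (ρ ∘ g)).map g := by
    ext s hs
    rw [withDensity_apply _ hs, Measure.map_apply hg hs, withDensity_apply _ (hg hs), hm,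
      setLIntegral_map hs hρm hg]
    rfl
  have hfinρ : IsFiniteMeasure (γ.withDensity (ρ ∘ g)) := by
    refine ⟨?_⟩
    have := congrArg (· Set.univ) hmap
    simp only [Measure.map_apply hg MeasurableSet.univ, Set.preimage_univ] at this
    rw [← this]
    exact (Measure.withDensity_rnDeriv_le μ m Set.univ).trans_lt (measure_lt_top _ _)
  have hac : (γ.withDensity fun x => (t x : ℝ≥0∞)).map g ≪ m :=
    (withDensity_absolutelyContinuous _ _).map hg
  set γ' := (γ.withDensity fun x => (t x : ℝ≥0∞)).map g with hγ'
  set d := γ'.rnDeriv m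
  have hdm : Measurable d := Measure.measurable_rnDeriv _ _
  have hγd : m.withDensity d = γ' := Measure.withDensity_rnDeriv_eq _ _ hac
  have : IsFiniteMeasure (m.withDensity d) := hγd ▸ inferInstance
  have : IsFiniteMeasure (m.withDensity ρ) := hmap ▸ inferInstance
  have h1 := klDiv_withDensity (m := m) (μ := μ) (μs := μ.singularPart m) hdm hρm hρ0 hρtop
    (Measure.mutuallySingular_singularPart _ _) (Measure.rnDeriv_add_singularPart μ m).symm
  have h2 := klDiv_withDensity (m := m) (μ := m.withDensity ρ) (μs := 0) hdm hρm hρ0 hρtop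
    Measure.MutuallySingular.zero_left (by simp)
  have h3 := klDiv_withDensity (m := γ) (μ := γ.withDensity (ρ ∘ g)) (μs := 0)
    ht.coe_nnreal_ennreal (hρm.comp hg) hρ0' hρtop' Measure.MutuallySingular.zero_left (by simp)
  have h4 := klDiv_map_le (μ := γ.withDensity fun x => (t x : ℝ≥0∞))
    (ν := γ.withDensity (ρ ∘ g)) hg
  rw [← hmap, ← hγ', ← hγd, h2, h3] at h4
  rw [← hγd, h1]
  gcongr
  simp only [Measure.coe_zero, Pi.zero_apply, add_zero] at h4
  refine h4.trans (lintegral_mono_ae ?_)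
  filter_upwards [hρ0', hρtop'] with x h0 htop
  lift ρ (g x) to ℝ≥0 using htop with r hr
  rw [Function.comp_apply, ← hr, ENNReal.toNNReal_coe,
    mul_reverseEntropy_klF (by simpa using h0) (ht0 x), klF_eq_ofReal_klFun]
  simp

/-- The relative entropy in terms of the reverse entropy: `∫ R(ρ) dγ + μ^⊥ ≤ F(γ | μ)`, here for the
image of `γ` under a map. -/
lemma lintegral_reverseEntropy_add_singularPart_le {α β : Type*} [MeasurableSpace α]
    [MeasurableSpace β] (γ : Measure α) (μ : Measure β) [IsFiniteMeasure γ] [IsFiniteMeasure μ]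
    {g : α → β} (hg : Measurable g) :
    ∫⁻ x, reverseEntropy klF (μ.rnDeriv (γ.map g) (g x)).toNNReal ∂γ
        + μ.singularPart (γ.map g) Set.univ ≤ klDiv (γ.map g) μ := by
  set m := γ.map g with hm
  by_cases hac : m ≪ μ
  swap
  · simp [klDiv_of_not_ac hac]
  have hρm : Measurable (μ.rnDeriv m) := Measure.measurable_rnDeriv _ _
  have hρtop : ∀ᵐ y ∂m, μ.rnDeriv m y ≠ ⊤ := Measure.rnDeriv_ne_top _ _
  have hρ0 : ∀ᵐ y ∂m, μ.rnDeriv m y ≠ 0 := (Measure.rnDeriv_pos' hac).mono fun _ h => h.ne'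
  have : IsFiniteMeasure (m.withDensity 1) := by rw [withDensity_one]; infer_instance
  have h1 := klDiv_withDensity (m := m) (μ := μ) (μs := μ.singularPart m) (t := 1)
    measurable_one hρm hρ0 hρtop
    (Measure.mutuallySingular_singularPart _ _) (Measure.rnDeriv_add_singularPart μ m).symm
  rw [withDensity_one] at h1
  rw [h1, ← lintegral_map (f := fun y => reverseEntropy klF (μ.rnDeriv m y).toNNReal)
    (measurable_reverseEntropy_klF.comp hρm.ennreal_toNNReal) hg]
  refine add_le_add_left (lintegral_mono_ae ?_) _
  filter_upwards [hρ0, hρtop] with y h0 htop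
  lift μ.rnDeriv m y to ℝ≥0 using htop with r hr
  have := mul_reverseEntropy_klF (s := r) (t := 1) (by simpa using h0) one_ne_zero
  simp only [ENNReal.coe_one, one_mul, div_one] at this
  rw [ENNReal.toNNReal_coe, this, klF_eq_ofReal_klFun]
  simp

/-! ### Integrals of extended-real-valued functions -/

/-- Moving the finite negative parts `N` and `n` across an identity of extended nonnegative
numbers. -/
lemma coe_ennreal_sub_eq_add_sub {P A p : ℝ≥0∞} {N n : ℝ≥0∞} (hN : N ≠ ⊤) (hn : n ≠ ⊤)
    (h : P + n = A + p + N) : (P : EReal) - N = A + ((p : EReal) - n) := by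
  lift N to ℝ≥0 using hN
  lift n to ℝ≥0 using hn
  induction A using ENNReal.recTopCoe with
  | top =>
    have hP : P = ⊤ := by simpa using h
    subst hP
    induction p using ENNReal.recTopCoe with
    | top => rfl
    | coe p => rfl
  | coe A =>
    induction p using ENNReal.recTopCoe with
    | top =>
      have hP : P = ⊤ := by simpa using h
      subst hP
      rfl
    | coe p =>
      have hP : P ≠ ⊤ := by rintro rfl; exact absurd h.symm (by simp)
      lift P to ℝ≥0 using hP
      have h' : (P : ℝ) + n = A + p + N := by exact_mod_cast h
      simp only [EReal.coe_nnreal_eq_coe_real]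
      norm_cast
      linarith

lemma toENNReal_coe_ennreal_add (a : ℝ≥0∞) {f : EReal} (hf : f ≠ ⊥) :
    ((a : EReal) + f).toENNReal + (-f).toENNReal
      = a + f.toENNReal + (-((a : EReal) + f)).toENNReal := by
  induction f using EReal.rec with
  | bot => exact absurd rfl hf
  | top => simp [EReal.add_top_of_ne_bot]
  | coe f =>
    induction a using ENNReal.recTopCoe with
    | top => simp [EReal.top_add_of_ne_bot]
    | coe a =>
      rw [EReal.coe_nnreal_eq_coe_real, ← EReal.coe_add, ← EReal.coe_neg, ← EReal.coe_neg]
      simp only [EReal.toENNReal_of_ne_top (EReal.coe_ne_top _), EReal.toReal_coe]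
      have ha : (0 : ℝ) ≤ a := a.coe_nonneg
      rw [← ENNReal.ofReal_coe_nnreal]
      rcases le_total 0 f with h | h <;> rcases le_total 0 ((a : ℝ) + f) with h' | h'
      · rw [ENNReal.ofReal_of_nonpos (neg_nonpos.2 h), ENNReal.ofReal_of_nonpos (neg_nonpos.2 h'),
          ENNReal.ofReal_add ha h]
      · have h1 : f = 0 := by linarith
        have h2 : (a : ℝ) = 0 := by linarith
        simp [h1, h2]
      · rw [ENNReal.ofReal_of_nonpos h, ENNReal.ofReal_of_nonpos (neg_nonpos.2 h'), add_zero,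
          add_zero, ← ENNReal.ofReal_add h' (neg_nonneg.2 h)]
        congr 1; ring
      · rw [ENNReal.ofReal_of_nonpos h, ENNReal.ofReal_of_nonpos h', zero_add,
          add_zero, ← ENNReal.ofReal_add ha (neg_nonneg.2 h')]
        congr 1; ring

lemma erealIntegral_mono_ae {α : Type*} [MeasurableSpace α] {γ : Measure α} {f g : α → EReal}
    (h : f ≤ᵐ[γ] g) : erealIntegral f γ ≤ erealIntegral g γ := by
  refine EReal.sub_le_sub ?_ ?_ <;> refine EReal.coe_ennreal_le_coe_ennreal_iff.2
    (lintegral_mono_ae ?_) <;> filter_upwards [h] with x hx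
  · exact EReal.toENNReal_le_toENNReal hx
  · exact EReal.toENNReal_le_toENNReal (EReal.neg_le_neg_iff.2 hx)

lemma erealIntegral_coe_ennreal_add {α : Type*} [MeasurableSpace α] {γ : Measure α}
    {a : α → ℝ≥0∞} (ha : Measurable a) {f : α → EReal} (hf : Measurable f)
    (hfi : ∫⁻ x, (-f x).toENNReal ∂γ ≠ ⊤) :
    erealIntegral (fun x => (a x : EReal) + f x) γ
      = ((∫⁻ x, a x ∂γ : ℝ≥0∞) : EReal) + erealIntegral f γ := by
  have hf' : Measurable fun x => (-f x).toENNReal := hf.neg.ereal_toENNReal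
  have hm : Measurable fun x => (-((a x : EReal) + f x)).toENNReal :=
    (ha.coe_ereal_ennreal.add hf).neg.ereal_toENNReal
  have hle : ∫⁻ x, (-((a x : EReal) + f x)).toENNReal ∂γ ≤ ∫⁻ x, (-f x).toENNReal ∂γ := by
    refine lintegral_mono fun x => EReal.toENNReal_le_toENNReal (EReal.neg_le_neg_iff.2 ?_)
    exact le_add_of_nonneg_left (EReal.coe_ennreal_nonneg _)
  refine coe_ennreal_sub_eq_add_sub (ne_top_of_le_ne_top hfi hle) hfi ?_
  rw [← lintegral_add_right _ hf', ← lintegral_add_left ha,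
    ← lintegral_add_right _ hm]
  refine lintegral_congr_ae ?_
  filter_upwards [ae_lt_top hf' hfi] with x hx
  exact toENNReal_coe_ennreal_add _ fun h => by simp [h] at hx

lemma erealIntegral_withDensity {α : Type*} [MeasurableSpace α] {γ : Measure α}
    {t : α → ℝ≥0} (ht : Measurable t) {c : α → EReal} (hc : Measurable c) :
    erealIntegral c (γ.withDensity fun x => t x)
      = erealIntegral (fun x => ((t x : ℝ) : EReal) * c x) γ := by
  have key : ∀ f : α → EReal, Measurable f →
      ∫⁻ x, (f x).toENNReal ∂(γ.withDensity fun x => (t x : ℝ≥0∞))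
        = ∫⁻ x, (((t x : ℝ) : EReal) * f x).toENNReal ∂γ := fun f hf => by
    rw [lintegral_withDensity_eq_lintegral_mul _ ht.coe_nnreal_ennreal hf.ereal_toENNReal]
    refine lintegral_congr fun x => ?_
    rw [← EReal.coe_nnreal_eq_coe_real, EReal.toENNReal_mul (EReal.coe_ennreal_nonneg _),
      EReal.toENNReal_coe]
    rfl
  rw [erealIntegral, erealIntegral, key c hc, key (fun x => -c x) hc.neg]
  simp only [mul_neg]

/-! ### The perspective cost and its minimiser -/

lemma coe_mul_add_eq {t : ℝ≥0} {ε : ℝ} (hε : 0 ≤ ε) (A B C : ℝ≥0∞) (c : EReal) :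
    ((t : ℝ) : EReal) * ((A : EReal) + (B : EReal) + (ε : EReal) * (C : EReal) + c)
      = ((t * A + t * B + ENNReal.ofReal ε * (t * C) : ℝ≥0∞) : EReal)
        + ((t : ℝ) : EReal) * c := by
  have h0 : (0 : EReal) ≤ ((t : ℝ) : EReal) := EReal.coe_nonneg.2 t.coe_nonneg
  have h1 : ((t : ℝ) : EReal) ≠ ⊤ := EReal.coe_ne_top _
  rw [EReal.left_distrib_of_nonneg_of_ne_top h0 h1, EReal.left_distrib_of_nonneg_of_ne_top h0 h1,
    EReal.left_distrib_of_nonneg_of_ne_top h0 h1]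
  simp only [EReal.coe_ennreal_add, EReal.coe_ennreal_mul, EReal.coe_ennreal_ofReal,
    EReal.coe_nnreal_eq_coe_real, max_eq_left hε]
  rw [mul_left_comm]

/-- The minimiser `exp ((log s₀ + log s₁ + ε log S - c) / (2 + ε))` of the perspective function
`t ↦ t (R(s₀/t) + R(s₁/t) + ε R(S/t) + c)`; it is set to `1` where this function is identically
`+∞`. -/
noncomputable def optimalScale (ε : ℝ) (s₀ s₁ S : ℝ≥0) (c : EReal) : ℝ≥0 :=
  open Classical in
  if s₀ = 0 ∨ s₁ = 0 ∨ S = 0 ∨ c = ⊤ then 1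
  else Real.toNNReal
    (Real.exp ((Real.log s₀ + Real.log s₁ + ε * Real.log S - c.toReal) / (2 + ε)))

lemma optimalScale_pos (ε : ℝ) (s₀ s₁ S : ℝ≥0) (c : EReal) : 0 < optimalScale ε s₀ s₁ S c := by
  unfold optimalScale
  split_ifs
  · exact one_pos
  · exact Real.toNNReal_pos.2 (Real.exp_pos _)

lemma measurable_optimalScale {α : Type*} [MeasurableSpace α] (ε : ℝ) {s₀ s₁ S : α → ℝ≥0}
    {c : α → EReal} (h₀ : Measurable s₀) (h₁ : Measurable s₁) (hS : Measurable S)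
    (hc : Measurable c) : Measurable fun x => optimalScale ε (s₀ x) (s₁ x) (S x) (c x) := by
  unfold optimalScale
  refine Measurable.ite ?_ measurable_const ?_
  · exact (h₀ (measurableSet_singleton 0)).union ((h₁ (measurableSet_singleton 0)).union
      ((hS (measurableSet_singleton 0)).union (hc (measurableSet_singleton ⊤))))
  · have := hc.ereal_toReal
    fun_prop

/-- The weighted geometric mean of `s₀, s₁, S` is bounded by their sum, so the optimal scale is
integrable as soon as the densities are. -/
lemma optimalScale_le {ε : ℝ} (hε : 0 < ε) (s₀ s₁ S : ℝ≥0) {c : EReal} {K : ℝ}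
    (hK : (K : EReal) ≤ c) :
    optimalScale ε s₀ s₁ S c ≤ 1 + Real.toNNReal (Real.exp (-K / (2 + ε))) * (s₀ + s₁ + S) := by
  unfold optimalScale
  split_ifs with h
  · exact le_self_add
  · push Not at h
    obtain ⟨h0, h1, h2, hc⟩ := h
    have hcK : K ≤ c.toReal := by
      have : c ≠ ⊥ := fun h => by simp [h] at hK
      rwa [← EReal.coe_le_coe_iff, EReal.coe_toReal hc this]
    refine le_trans ?_ le_add_self
    have p0 : (0 : ℝ) < s₀ := by positivity
    have p1 : (0 : ℝ) < s₁ := by positivity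
    have p2 : (0 : ℝ) < S := by positivity
    set M : ℝ := s₀ + s₁ + S with hM
    have hMpos : 0 < M := by positivity
    have l0 : Real.log s₀ ≤ Real.log M := Real.log_le_log p0 (by linarith)
    have l1 : Real.log s₁ ≤ Real.log M := Real.log_le_log p1 (by linarith)
    have l2 : Real.log S ≤ Real.log M := Real.log_le_log p2 (by linarith)
    rw [← NNReal.coe_le_coe, Real.coe_toNNReal _ (Real.exp_pos _).le]
    push_cast
    rw [Real.coe_toNNReal _ (Real.exp_pos _).le, ← hM]
    conv_rhs => rw [← Real.exp_log hMpos, ← Real.exp_add]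
    refine Real.exp_le_exp.2 ?_
    rw [div_add' _ _ _ (by positivity)]
    gcongr
    nlinarith [mul_le_mul_of_nonneg_left l2 hε.le]

lemma coe_mul_klF {s t : ℝ≥0} (hs : s ≠ 0) :
    (s : ℝ≥0∞) * klF (t / s)
      = ENNReal.ofReal (t * Real.log (t / s) - t + s) := by
  rw [klF, ← ENNReal.ofReal_coe_nnreal, ← ENNReal.ofReal_mul s.coe_nonneg]
  congr 1
  have : (s : ℝ) ≠ 0 := by exact_mod_cast hs
  push_cast
  field_simp

lemma mul_log_div_sub_add_nonneg {s t : ℝ} (hs : 0 < s) (ht : 0 < t) :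
    0 ≤ t * Real.log (t / s) - t + s := by
  have := InformationTheory.klFun_nonneg (x := t / s) (by positivity)
  rw [InformationTheory.klFun_apply] at this
  have h2 := mul_nonneg hs.le this
  have : s * (t / s * Real.log (t / s) + 1 - t / s) = t * Real.log (t / s) - t + s := by
    field_simp; ring
  linarith

lemma perspective_klF_eq_coe {ε : ℝ} (hε : 0 < ε) {s₀ s₁ S t : ℝ≥0} (h0 : s₀ ≠ 0) (h1 : s₁ ≠ 0)
    (h2 : S ≠ 0) (ht : t ≠ 0) (c : ℝ) :
    ((t : ℝ) : EReal) *
      ((reverseEntropy klF (s₀ / t) : EReal) + (reverseEntropy klF (s₁ / t) : EReal)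
        + (ε : EReal) * (reverseEntropy klF (S / t) : EReal) + c)
      = (((t * Real.log (t / s₀) - t + s₀) + (t * Real.log (t / s₁) - t + s₁)
        + ε * (t * Real.log (t / S) - t + S) + t * c : ℝ) : EReal) := by
  have p0 : (0 : ℝ) < s₀ := by positivity
  have p1 : (0 : ℝ) < s₁ := by positivity
  have p2 : (0 : ℝ) < S := by positivity
  have pt : (0 : ℝ) < t := by positivity
  rw [coe_mul_add_eq hε.le, mul_reverseEntropy_klF h0 ht, mul_reverseEntropy_klF h1 ht,
    mul_reverseEntropy_klF h2 ht, coe_mul_klF h0, coe_mul_klF h1, coe_mul_klF h2]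
  simp only [EReal.coe_ennreal_add, EReal.coe_ennreal_mul, EReal.coe_ennreal_ofReal,
    max_eq_left hε.le, max_eq_left (mul_log_div_sub_add_nonneg p0 pt),
    max_eq_left (mul_log_div_sub_add_nonneg p1 pt),
    max_eq_left (mul_log_div_sub_add_nonneg p2 pt)]
  norm_cast

lemma perspective_klF_eq_top {ε : ℝ} (hε : 0 < ε) {s₀ s₁ S t : ℝ≥0} (ht : t ≠ 0) {c : EReal}
    (hc : c ≠ ⊥) (h : s₀ = 0 ∨ s₁ = 0 ∨ S = 0 ∨ c = ⊤) :
    ((t : ℝ) : EReal) *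
      ((reverseEntropy klF (s₀ / t) : EReal) + (reverseEntropy klF (s₁ / t) : EReal)
        + (ε : EReal) * (reverseEntropy klF (S / t) : EReal) + c) = ⊤ := by
  have pt : (0 : ℝ) < t := by positivity
  rw [coe_mul_add_eq hε.le]
  have htop : (t : ℝ≥0∞) * ⊤ = ⊤ := ENNReal.mul_top (by simpa using ht)
  have hcb : ((t : ℝ) : EReal) * c ≠ ⊥ := by
    induction c using EReal.rec with
    | bot => exact absurd rfl hc
    | top => simp [EReal.coe_mul_top_of_pos pt]
    | coe c => rw [← EReal.coe_mul]; exact EReal.coe_ne_bot _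
  rcases h with rfl | rfl | rfl | rfl
  · simp [reverseEntropy_klF_zero, htop, EReal.top_add_of_ne_bot hcb]
  · simp [reverseEntropy_klF_zero, htop, EReal.top_add_of_ne_bot hcb]
  · simp [reverseEntropy_klF_zero, htop, EReal.top_add_of_ne_bot hcb, ENNReal.mul_top, hε]
  · rw [EReal.coe_mul_top_of_pos pt]
    exact EReal.add_top_of_ne_bot (EReal.coe_ennreal_ne_bot _)

/-- The infimum defining the perspective cost is attained at `optimalScale`. -/
lemma perspCostReg_klF_eq {X : Type*} {ε : ℝ} (hε : 0 < ε) {c : X × X → EReal} {x₀ x₁ : X}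
    (hc : c (x₀, x₁) ≠ ⊥) (s₀ s₁ S : ℝ≥0) {t : ℝ≥0}
    (ht : t = optimalScale ε s₀ s₁ S (c (x₀, x₁))) :
    perspCostReg klF ε c x₀ s₀ x₁ s₁ S = ((t : ℝ) : EReal) *
      ((reverseEntropy klF (s₀ / t) : EReal) + (reverseEntropy klF (s₁ / t) : EReal)
        + (ε : EReal) * (reverseEntropy klF (S / t) : EReal) + c (x₀, x₁)) := by
  have ht0 : 0 < t := ht ▸ optimalScale_pos _ _ _ _ _
  refine le_antisymm (iInf₂_le t ht0) (le_iInf₂ fun u hu => ?_)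
  generalize c (x₀, x₁) = d at hc ht
  by_cases h : s₀ = 0 ∨ s₁ = 0 ∨ S = 0 ∨ d = ⊤
  · rw [perspective_klF_eq_top hε hu.ne' hc h]
    exact le_top
  · rw [optimalScale, if_neg h] at ht
    push Not at h
    obtain ⟨h0, h1, h2, hd⟩ := h
    lift d to ℝ using ⟨hd, hc⟩
    rw [perspective_klF_eq_coe hε h0 h1 h2 ht0.ne', perspective_klF_eq_coe hε h0 h1 h2 hu.ne',
      EReal.coe_le_coe_iff]
    have p0 : (0 : ℝ) < s₀ := by positivity
    have p1 : (0 : ℝ) < s₁ := by positivity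
    have p2 : (0 : ℝ) < S := by positivity
    have pt : (0 : ℝ) < t := ht0
    have pu : (0 : ℝ) < u := hu
    have hlog : (2 + ε) * Real.log t = Real.log s₀ + Real.log s₁ + ε * Real.log S - d := by
      rw [ht, Real.coe_toNNReal _ (Real.exp_pos _).le, Real.log_exp, EReal.toReal_coe]
      field_simp
    have hu := mul_nonneg (show 0 ≤ 2 + ε by positivity) (mul_log_div_sub_add_nonneg pt pu)
    rw [Real.log_div pu.ne' pt.ne'] at hu
    rw [Real.log_div pu.ne' p0.ne', Real.log_div pu.ne' p1.ne', Real.log_div pu.ne' p2.ne',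
      Real.log_div pt.ne' p0.ne', Real.log_div pt.ne' p1.ne', Real.log_div pt.ne' p2.ne']
    -- the difference of the two sides is `(2 + ε) (u log (u / t) - u + t)`
    linear_combination hu + (t - u : ℝ) * hlog

/-! ### Comparison of the two functionals -/

lemma lintegral_neg_coe_mul_ne_top {α : Type*} [MeasurableSpace α] {γ : Measure α}
    {t : α → ℝ≥0} (ht : ∫⁻ x, t x ∂γ ≠ ⊤) {c : α → EReal} {K : ℝ}
    (hK : ∀ x, (K : EReal) ≤ c x) :
    ∫⁻ x, (-(((t x : ℝ) : EReal) * c x)).toENNReal ∂γ ≠ ⊤ := by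
  have hle : ∀ x, (-(((t x : ℝ) : EReal) * c x)).toENNReal ≤ ENNReal.ofReal (-K) * t x :=
    fun x => by
      have h0 : (0 : EReal) ≤ ((t x : ℝ≥0∞) : EReal) := EReal.coe_ennreal_nonneg _
      rw [← mul_neg, ← EReal.coe_nnreal_eq_coe_real, EReal.toENNReal_mul h0, EReal.toENNReal_coe,
        mul_comm]
      gcongr
      refine (EReal.toENNReal_le_toENNReal (EReal.neg_le_neg_iff.2 (hK x))).trans_eq ?_
      rw [← EReal.coe_neg, EReal.toENNReal_of_ne_top (EReal.coe_ne_top _), EReal.toReal_coe]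
  refine ne_top_of_le_ne_top ?_ (lintegral_mono hle)
  rw [lintegral_const_mul' _ _ ENNReal.ofReal_ne_top]
  exact ENNReal.mul_ne_top ENNReal.ofReal_ne_top ht

lemma lintegral_rnDeriv_map_ne_top {α β : Type*} [MeasurableSpace α] [MeasurableSpace β]
    (γ : Measure α) (μ : Measure β) [IsFiniteMeasure μ] {g : α → β} (hg : Measurable g) :
    ∫⁻ x, (((μ.rnDeriv (γ.map g) (g x)).toNNReal : ℝ≥0) : ℝ≥0∞) ∂γ ≠ ⊤ := by
  refine ne_top_of_le_ne_top ?_ (lintegral_mono fun p => ENNReal.coe_toNNReal_le_self)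
  rw [← lintegral_map (Measure.measurable_rnDeriv _ _) hg]
  exact (Measure.lintegral_rnDeriv_lt_top _ _).ne

variable {X : Type*} [MeasurableSpace X]

/-- The third entropy is written with `γ.map id`, so that all three entropies are of the form
`klDiv (γ.map g) μ`. -/
lemma primalReg_klF {ε : ℝ} (hε : 0 ≤ ε) (c : X × X → EReal) (μ₀ μ₁ : Measure X)
    (ν γ : Measure (X × X)) [IsFiniteMeasure μ₀] [IsFiniteMeasure μ₁] [IsFiniteMeasure ν]
    [IsFiniteMeasure γ] :
    primalReg klF ε c μ₀ μ₁ ν γ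
      = ((InformationTheory.klDiv (γ.map Prod.fst) μ₀ + InformationTheory.klDiv (γ.map Prod.snd) μ₁
          + ENNReal.ofReal ε * InformationTheory.klDiv (γ.map id) ν : ℝ≥0∞) : EReal)
        + erealIntegral c γ := by
  rw [primalReg, primal, relEntropy_klF, relEntropy_klF, relEntropy_klF, Measure.map_id,
    EReal.coe_ennreal_add (_ + _), EReal.coe_ennreal_mul, EReal.coe_ennreal_ofReal,
    max_eq_left hε, add_right_comm]

lemma erealIntegral_perspective {ε : ℝ} (hε : 0 ≤ ε) {c : X × X → EReal} (hc : Measurable c)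
    {K : ℝ} (hK : ∀ p, (K : EReal) ≤ c p) (γ : Measure (X × X))
    {s₀ s₁ S t : X × X → ℝ≥0} (h₀ : Measurable s₀) (h₁ : Measurable s₁) (hS : Measurable S)
    (ht : Measurable t) (hti : ∫⁻ p, t p ∂γ ≠ ⊤) :
    erealIntegral (fun p => ((t p : ℝ) : EReal) *
      ((reverseEntropy klF (s₀ p / t p) : EReal) + (reverseEntropy klF (s₁ p / t p) : EReal)
        + (ε : EReal) * (reverseEntropy klF (S p / t p) : EReal) + c p)) γ
      = ((∫⁻ p, t p * reverseEntropy klF (s₀ p / t p) ∂γ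
          + ∫⁻ p, t p * reverseEntropy klF (s₁ p / t p) ∂γ
          + ENNReal.ofReal ε * ∫⁻ p, t p * reverseEntropy klF (S p / t p) ∂γ : ℝ≥0∞) : EReal)
        + erealIntegral c (γ.withDensity fun p => t p) := by
  have hm : ∀ {s : X × X → ℝ≥0}, Measurable s →
      Measurable fun p => (t p : ℝ≥0∞) * reverseEntropy klF (s p / t p) := fun hs =>
    ht.coe_nnreal_ennreal.mul (measurable_reverseEntropy_klF.comp (hs.div ht))
  simp_rw [coe_mul_add_eq hε]
  have hm01 : Measurable fun p => (t p : ℝ≥0∞) * reverseEntropy klF (s₀ p / t p)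
      + t p * reverseEntropy klF (s₁ p / t p) := (hm h₀).add (hm h₁)
  have hm01S : Measurable fun p => (t p : ℝ≥0∞) * reverseEntropy klF (s₀ p / t p)
      + t p * reverseEntropy klF (s₁ p / t p)
      + ENNReal.ofReal ε * (t p * reverseEntropy klF (S p / t p)) :=
    hm01.add ((hm hS).const_mul _)
  have htc : Measurable fun p => ((t p : ℝ) : EReal) * c p :=
    ht.coe_nnreal_real.coe_real_ereal.mul hc
  rw [erealIntegral_coe_ennreal_add hm01S htc (lintegral_neg_coe_mul_ne_top hti hK),
    lintegral_add_left hm01, lintegral_add_left (hm h₀),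
    lintegral_const_mul _ (hm hS), erealIntegral_withDensity ht hc]

/-- As in `primalReg_klF`, the plan `γ` is written as `γ.map id` in the decomposition of `ν`. -/
lemma homogReg_klF {ε : ℝ} (hε : 0 ≤ ε) (c : X × X → EReal) (μ₀ μ₁ : Measure X)
    (ν γ : Measure (X × X)) :
    homogReg klF ε c μ₀ μ₁ ν γ =
      erealIntegral (fun p : X × X =>
        perspCostReg klF ε c p.1 (μ₀.rnDeriv (γ.map Prod.fst) p.1).toNNReal
          p.2 (μ₁.rnDeriv (γ.map Prod.snd) p.2).toNNReal (ν.rnDeriv (γ.map id) p).toNNReal) γ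
      + ((μ₀.singularPart (γ.map Prod.fst) Set.univ + μ₁.singularPart (γ.map Prod.snd) Set.univ
          + ENNReal.ofReal ε * ν.singularPart (γ.map id) Set.univ : ℝ≥0∞) : EReal) := by
  rw [homogReg, klF_zero, Measure.map_id, EReal.coe_ennreal_one, one_mul, EReal.coe_ennreal_add,
    EReal.coe_ennreal_add, EReal.coe_ennreal_mul, EReal.coe_ennreal_ofReal, max_eq_left hε]

/-- The plan `γ` itself is a competitor: taking `t = 1` in the perspective cost gives back the
entropies of the marginals of `γ`. -/
lemma homogReg_klF_le_primalReg {ε : ℝ} (hε : 0 ≤ ε) {c : X × X → EReal} (hc : Measurable c)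
    {K : ℝ} (hK : ∀ p, (K : EReal) ≤ c p) (μ₀ μ₁ : Measure X)
    (ν γ : Measure (X × X)) [IsFiniteMeasure μ₀] [IsFiniteMeasure μ₁] [IsFiniteMeasure ν]
    [IsFiniteMeasure γ] :
    homogReg klF ε c μ₀ μ₁ ν γ ≤ primalReg klF ε c μ₀ μ₁ ν γ := by
  have hmono := erealIntegral_mono_ae (γ := γ) <| ae_of_all _ fun p : X × X =>
    iInf₂_le (f := fun (t : ℝ≥0) (_ : 0 < t) => ((t : ℝ) : EReal) *
      ((reverseEntropy klF ((μ₀.rnDeriv (γ.map Prod.fst) p.1).toNNReal / t) : EReal)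
        + (reverseEntropy klF ((μ₁.rnDeriv (γ.map Prod.snd) p.2).toNNReal / t) : EReal)
        + (ε : EReal) * (reverseEntropy klF ((ν.rnDeriv (γ.map id) p).toNNReal / t) : EReal)
        + c (p.1, p.2))) 1 one_pos
  have hpersp := erealIntegral_perspective hε (t := fun _ => 1)
    (s₀ := fun p => (μ₀.rnDeriv (γ.map Prod.fst) p.1).toNNReal)
    (s₁ := fun p => (μ₁.rnDeriv (γ.map Prod.snd) p.2).toNNReal)
    (S := fun p => (ν.rnDeriv (γ.map id) p).toNNReal) hc hK γ
    ((Measure.measurable_rnDeriv _ _).comp measurable_fst).ennreal_toNNReal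
    ((Measure.measurable_rnDeriv _ _).comp measurable_snd).ennreal_toNNReal
    (Measure.measurable_rnDeriv _ _).ennreal_toNNReal measurable_const (by simp)
  rw [hpersp] at hmono
  simp only [ENNReal.coe_one, one_mul, div_one] at hmono
  rw [show γ.withDensity (fun _ => 1) = γ from withDensity_one] at hmono
  rw [primalReg_klF hε, homogReg_klF hε]
  refine (add_le_add_left hmono _).trans ?_
  rw [add_right_comm _ (erealIntegral _ _), ← EReal.coe_ennreal_add]
  refine add_le_add_left (EReal.coe_ennreal_le_coe_ennreal_iff.2 ?_) _
  rw [add_add_add_comm, add_add_add_comm (∫⁻ _, _ ∂_), ← mul_add]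
  gcongr
  · exact lintegral_reverseEntropy_add_singularPart_le γ μ₀ measurable_fst
  · exact lintegral_reverseEntropy_add_singularPart_le γ μ₁ measurable_snd
  · exact lintegral_reverseEntropy_add_singularPart_le γ ν measurable_id

/-- Rescaling `γ` by the pointwise minimiser of the perspective function yields a plan whose
entropy-transport cost is at most the homogeneous functional at `γ`; passing from the joint
entropies to those of the marginals is the data processing inequality. -/
lemma exists_primalReg_le_homogReg_klF {ε : ℝ} (hε : 0 < ε) {c : X × X → EReal}
    (hc : Measurable c) {K : ℝ} (hK : ∀ p, (K : EReal) ≤ c p) (μ₀ μ₁ : Measure X)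
    (ν γ : Measure (X × X)) [IsFiniteMeasure μ₀] [IsFiniteMeasure μ₁] [IsFiniteMeasure ν]
    [IsFiniteMeasure γ] :
    ∃ γ' : FiniteMeasure (X × X),
      primalReg klF ε c μ₀ μ₁ ν γ' ≤ homogReg klF ε c μ₀ μ₁ ν γ := by
  set s₀ : X × X → ℝ≥0 := fun p => (μ₀.rnDeriv (γ.map Prod.fst) p.1).toNNReal
  set s₁ : X × X → ℝ≥0 := fun p => (μ₁.rnDeriv (γ.map Prod.snd) p.2).toNNReal
  set S : X × X → ℝ≥0 := fun p => (ν.rnDeriv (γ.map id) p).toNNReal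
  have h₀ : Measurable s₀ :=
    ((Measure.measurable_rnDeriv _ _).comp measurable_fst).ennreal_toNNReal
  have h₁ : Measurable s₁ :=
    ((Measure.measurable_rnDeriv _ _).comp measurable_snd).ennreal_toNNReal
  have hSm : Measurable S := (Measure.measurable_rnDeriv _ _).ennreal_toNNReal
  set t : X × X → ℝ≥0 := fun p => optimalScale ε (s₀ p) (s₁ p) (S p) (c p)
  have htm : Measurable t := measurable_optimalScale ε h₀ h₁ hSm hc
  have hti : ∫⁻ p, t p ∂γ ≠ ⊤ := by
    refine ne_top_of_le_ne_top ?_ (lintegral_mono fun p => ENNReal.coe_le_coe.2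
      (optimalScale_le hε (s₀ p) (s₁ p) (S p) (hK p)))
    push_cast
    have h01 : Measurable fun p => (s₀ p : ℝ≥0∞) + s₁ p :=
      h₀.coe_nnreal_ennreal.add h₁.coe_nnreal_ennreal
    rw [lintegral_add_left measurable_const, lintegral_const_mul' _ _ ENNReal.coe_ne_top,
      lintegral_add_left h01,
      lintegral_add_left h₀.coe_nnreal_ennreal]
    exact ENNReal.add_ne_top.2 ⟨by simp, ENNReal.mul_ne_top ENNReal.coe_ne_top
      (ENNReal.add_ne_top.2 ⟨ENNReal.add_ne_top.2 ⟨lintegral_rnDeriv_map_ne_top γ μ₀ measurable_fst,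
        lintegral_rnDeriv_map_ne_top γ μ₁ measurable_snd⟩,
        lintegral_rnDeriv_map_ne_top γ ν measurable_id⟩)⟩
  have hfin : IsFiniteMeasure (γ.withDensity fun p => t p) := isFiniteMeasure_withDensity hti
  have ht0 : ∀ p, t p ≠ 0 := fun p => (optimalScale_pos _ _ _ _ _).ne'
  refine ⟨⟨γ.withDensity fun p => t p, hfin⟩, ?_⟩
  rw [FiniteMeasure.toMeasure_mk, primalReg_klF hε.le, homogReg_klF hε.le]
  have hH : (fun p : X × X => perspCostReg klF ε c p.1 (s₀ p) p.2 (s₁ p) (S p))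
      = fun p => ((t p : ℝ) : EReal) *
        ((reverseEntropy klF (s₀ p / t p) : EReal) + (reverseEntropy klF (s₁ p / t p) : EReal)
        + (ε : EReal) * (reverseEntropy klF (S p / t p) : EReal) + c p) :=
    funext fun p => perspCostReg_klF_eq hε
      (fun h => by simpa [h] using hK (p.1, p.2)) _ _ _ rfl
  rw [hH, erealIntegral_perspective hε.le hc hK γ h₀ h₁ hSm htm hti,
    add_right_comm _ (erealIntegral _ _), ← EReal.coe_ennreal_add]
  refine add_le_add_left (EReal.coe_ennreal_le_coe_ennreal_iff.2 ?_) _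
  rw [add_add_add_comm, add_add_add_comm (∫⁻ _, _ ∂_), ← mul_add]
  gcongr
  · exact klDiv_map_withDensity_le γ μ₀ measurable_fst htm ht0
  · exact klDiv_map_withDensity_le γ μ₁ measurable_snd htm ht0
  · exact klDiv_map_withDensity_le γ ν measurable_id htm ht0

end EUOT

theorem mainTheorem2 {X : Type*} [MetricSpace X] [CompleteSpace X]
    [TopologicalSpace.SeparableSpace X] [MeasurableSpace X] [BorelSpace X]
    (ε : ℝ) (hε : 0 < ε)
    (c : X × X → EReal) (hc : LowerSemicontinuous c)
    (hc_bdd : ∃ K : ℝ, ∀ p, (K : EReal) ≤ c p)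
    (μ₀ μ₁ : FiniteMeasure X) (ν : FiniteMeasure (X × X)) :
    EUOT.UOTReg EUOT.klF ε c μ₀ μ₁ ν =
      ⨅ γ : FiniteMeasure (X × X), EUOT.homogReg EUOT.klF ε c μ₀ μ₁ ν γ := by
  obtain ⟨K, hK⟩ := hc_bdd
  have : SecondCountableTopology X := UniformSpace.secondCountable_of_separable X
  have hcm : Measurable c := hc.measurable
  refine le_antisymm (le_iInf fun γ => ?_) (iInf_mono fun γ => ?_)
  · obtain ⟨γ', h⟩ := EUOT.exists_primalReg_le_homogReg_klF hε hcm hK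
      (μ₀ : Measure X) μ₁ (ν : Measure (X × X)) γ
    exact (iInf_le _ γ').trans h
  · exact EUOT.homogReg_klF_le_primalReg hε.le hcm hK _ _ _ _
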